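/- Let $\mathcal H$ be a complex Hilbert space and let $K$ be a bounded, boundedly invertible operator on $\mathcal H$. A densely defined closable operator $T$ in $\mathcal H$ is called $K$-invariant if $K^*TK=T$, that is, $\mathcal D(T)=\{f\in\mathcal H : Kf\in\mathcal D(T)\}$ and $K^*TKf=Tf$ for all $f\in\mathcal D(T)$. Let $S$ be a densely defined, closed, symmetric operator in $\mathcal H$ that is strictly positive, i.e. $\langle f,Sf\rangle\ge\varepsilon\|f\|^2$ for all $f\in\mathcal D(S)$ and some $\varepsilon>0$, and suppose that $S$ is $K$-invariant. Let $S_F$ be the Friedrichs extension of $S$, i.e. the restriction of $S^*$ to the set of all $f\in\mathcal D(S^*)$ for which there is a sequence $(f_n)$ in $\mathcal D(S)$ with $f_n\to f$ and $\langle f_n-f_m,S(f_n-f_m)\rangle\to0$ as $n,m\to\infty$. Let $\mathfrak M$ be a closed subspace of $\ker(S^*)$ with $K^{-1}\mathfrak M=\mathfrak M$. Then $S_F$ is a bijection of $\mathcal D(S_F)$ onto $\mathcal H$, the three subspaces $\mathcal D(S)$, $\mathfrak M$ and $\{S_F^{-1}\eta : \eta\in\mathfrak M^\perp\cap\ker(S^*)\}$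 are linearly independent and contained in $\mathcal D(S^*)$, and the operator $$S_{\mathfrak M}=S^*\upharpoonright_{\mathcal D(S_{\mathfrak M})},\qquad \mathcal D(S_{\mathfrak M})=\mathcal D(S)\dot+\mathfrak M\dot+\{S_F^{-1}\eta : \eta\in\mathfrak M^\perp\cap\ker(S^*)\},$$ is an extension of $S$ which is densely defined, closable and $K$-invariant. -/

import Mathlib

open scoped InnerProductSpace LinearPMap Topology
open Filter

namespace KInvariant

variable {H : Type*} [NormedAddCommGroup H] [InnerProductSpace ℂ H]

/-- `S` is a (densely defined) nonnegative symmetric operator in `H`. -/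
structure IsNonnegSymmetric (S : H →ₗ.[ℂ] H) : Prop where
  dense : Dense (S.domain : Set H)
  symm : ∀ f g : S.domain, ⟪S f, (g : H)⟫_ℂ = ⟪(f : H), S g⟫_ℂ
  nonneg : ∀ f : S.domain, 0 ≤ (⟪(f : H), S f⟫_ℂ).re

/-- `S` is a (densely defined) strictly positive symmetric operator in `H`: `S ≥ ε I` for
some `ε > 0`. -/
structure IsStrictlyPosSymmetric (S : H →ₗ.[ℂ] H) : Prop where
  dense : Dense (S.domain : Set H)
  symm : ∀ f g : S.domain, ⟪S f, (g : H)⟫_ℂ = ⟪(f : H), S g⟫_ℂ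
  pos : ∃ ε : ℝ, 0 < ε ∧ ∀ f : S.domain, ε * ‖(f : H)‖ ^ 2 ≤ (⟪(f : H), S f⟫_ℂ).re

theorem IsStrictlyPosSymmetric.isNonnegSymmetric {S : H →ₗ.[ℂ] H}
    (hS : IsStrictlyPosSymmetric S) : IsNonnegSymmetric S where
  dense := hS.dense
  symm := hS.symm
  nonneg f := by
    obtain ⟨ε, hε, h⟩ := hS.pos
    exact le_trans (by positivity) (h f)

/-- `g` is the limit in `H` of a sequence `f_n` in `D(S)` with
`⟨f_n - f_m, S (f_n - f_m)⟩ → 0` as `n, m → ∞`. -/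
def InFormDomain (S : H →ₗ.[ℂ] H) (g : H) : Prop :=
  ∃ f : ℕ → S.domain, Tendsto (fun n => (f n : H)) atTop (𝓝 g) ∧
    Tendsto (fun p : ℕ × ℕ => ⟪((f p.1 - f p.2 : S.domain) : H), S (f p.1 - f p.2)⟫_ℂ)
      atTop (𝓝 0)

theorem IsNonnegSymmetric.inner_eq_re {S : H →ₗ.[ℂ] H} (hS : IsNonnegSymmetric S)
    (f : S.domain) : ⟪(f : H), S f⟫_ℂ = ((⟪(f : H), S f⟫_ℂ).re : ℂ) := by
  have h : (starRingEnd ℂ) ⟪(f : H), S f⟫_ℂ = ⟪(f : H), S f⟫_ℂ := by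
    rw [inner_conj_symm, hS.symm]
  exact (Complex.conj_eq_iff_re.mp h).symm

theorem IsNonnegSymmetric.norm_inner_add_le {S : H →ₗ.[ℂ] H} (hS : IsNonnegSymmetric S)
    (f g : S.domain) :
    ‖⟪((f + g : S.domain) : H), S (f + g)⟫_ℂ‖ ≤
      2 * ‖⟪(f : H), S f⟫_ℂ‖ + 2 * ‖⟪(g : H), S g⟫_ℂ‖ := by
  have key : ∀ h : S.domain, ‖⟪(h : H), S h⟫_ℂ‖ = (⟪(h : H), S h⟫_ℂ).re := fun h => by
    rw [hS.inner_eq_re h, Complex.norm_real, Complex.ofReal_re, Real.norm_of_nonneg (hS.nonneg h)]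
  rw [key, key, key]
  have h1 := hS.nonneg (f - g)
  simp only [LinearPMap.map_sub, LinearPMap.map_add, Submodule.coe_sub, Submodule.coe_add,
    inner_add_left, inner_add_right, inner_sub_left, inner_sub_right, Complex.add_re,
    Complex.sub_re] at h1 ⊢
  linarith

/-- The domain of the Friedrichs extension. -/
def friedrichsDomain (S : H →ₗ.[ℂ] H) (hS : IsNonnegSymmetric S) [CompleteSpace H] :
    Submodule ℂ H where
  carrier := {g | g ∈ (S†).domain ∧ InFormDomain S g}
  zero_mem' := ⟨Submodule.zero_mem _, fun _ => 0, by simp, by simp⟩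
  add_mem' := by
    rintro a b ⟨ha, f, hf, hf'⟩ ⟨hb, g, hg, hg'⟩
    refine ⟨Submodule.add_mem _ ha hb, fun n => f n + g n, by simpa using hf.add hg, ?_⟩
    have h := (hf'.norm.const_mul 2).add (hg'.norm.const_mul 2)
    simp only [norm_zero, mul_zero, add_zero] at h
    refine squeeze_zero_norm (fun p => ?_) h
    rw [add_sub_add_comm]
    exact hS.norm_inner_add_le _ _
  smul_mem' := by
    rintro c a ⟨ha, f, hf, hf'⟩
    refine ⟨Submodule.smul_mem _ c ha, fun n => c • f n, by simpa using hf.const_smul c, ?_⟩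
    have h := (hf'.const_mul c).const_mul ((starRingEnd ℂ) c)
    simp only [mul_zero] at h
    refine h.congr fun p => ?_
    rw [← smul_sub, LinearPMap.map_smul, Submodule.coe_smul, inner_smul_left, inner_smul_right]

variable [CompleteSpace H]

/-- The Friedrichs extension `S_F` of a nonnegative symmetric operator `S`: the restriction of
`S*` to the vectors of `D(S*)` that lie in the domain of the closure of the form of `S`. -/
noncomputable def friedrichs (S : H →ₗ.[ℂ] H) (hS : IsNonnegSymmetric S) : H →ₗ.[ℂ] H where
  domain := friedrichsDomain S hS
  toFun := (S†).toFun ∘ₗ Submodule.inclusion fun _ h => h.1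

/-- The subspace `ker S*` of `H`. -/
noncomputable def kerAdjoint (S : H →ₗ.[ℂ] H) : Submodule ℂ H :=
  (LinearMap.ker (S†).toFun).map (S†).domain.subtype

/-- The subspace `{T⁻¹ η | η ∈ N}` of `H`, with `η` in the domain of `T⁻¹`. -/
noncomputable def inverseImage (T : H →ₗ.[ℂ] H) (N : Submodule ℂ H) : Submodule ℂ H :=
  (N.comap T.inverse.domain.subtype).map T.inverse.toFun

/-- The operator `K* T K`, with domain `{f | K f ∈ D(T)}`. -/
noncomputable def conjugate (K : H ≃L[ℂ] H) (T : H →ₗ.[ℂ] H) : H →ₗ.[ℂ] H where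
  domain := T.domain.comap (K : H →ₗ[ℂ] H)
  toFun := (ContinuousLinearMap.adjoint (K : H →L[ℂ] H) : H →ₗ[ℂ] H) ∘ₗ T.toFun ∘ₗ
    (K : H →ₗ[ℂ] H).restrict fun _ h => h

/-- A densely defined, closable operator `T` is `K`-invariant if `K* T K = T`, as an equality of
unbounded operators (equal domains and equal values). -/
structure IsKInvariant (K : H ≃L[ℂ] H) (T : H →ₗ.[ℂ] H) : Prop where
  dense : Dense (T.domain : Set H)
  closable : T.IsClosable
  conjugate_eq : conjugate K T = T

/-- The third summand `{S_F⁻¹ η | η ∈ M^⊥ ∩ ker S*}` in the domain of `S_M`. -/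
noncomputable def friedrichsPart (S : H →ₗ.[ℂ] H) (hS : IsNonnegSymmetric S)
    (M : Submodule ℂ H) : Submodule ℂ H :=
  inverseImage (friedrichs S hS) (Mᗮ ⊓ kerAdjoint S)

/-- The domain `D(S) + M + {S_F⁻¹ η | η ∈ M^⊥ ∩ ker S*}` of `S_M`. -/
noncomputable def extensionDomain (S : H →ₗ.[ℂ] H) (hS : IsNonnegSymmetric S)
    (M : Submodule ℂ H) : Submodule ℂ H :=
  S.domain ⊔ M ⊔ friedrichsPart S hS M

/-- The operator `S_M`: the restriction of `S*` to `D(S) + M + {S_F⁻¹ η | η ∈ M^⊥ ∩ ker S*}`. -/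
noncomputable def extension (S : H →ₗ.[ℂ] H) (hS : IsNonnegSymmetric S)
    (M : Submodule ℂ H) : H →ₗ.[ℂ] H :=
  (S†).domRestrict (extensionDomain S hS M)

end KInvariant

/-!
Let `V` be the energy space of `S`, the completion of `D(S)` for the inner product `⟪f, S g⟫`, and
let `ι : V → H` extend the inclusion of `D(S)`. A vector `ι v` satisfies `S* (ι v) = y` exactly
when `⟪v, f⟫ = ⟪y, f⟫` for all `f` in the dense subspace `D(S)` of `V`, that is, when `v = ι† y`.
Hence `S_F⁻¹` is the bounded operator `ι ι†`.

It follows that `ran S`, the set of `y` for which `(S_F⁻¹ y, y)` lies in the graph of `S`, is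
closed. So `Mᗮ` is the sum of `ran S` and `Mᗮ ∩ ker S*`, and applying `S_F⁻¹` turns `D(S_M)` into
`M + S_F⁻¹ Mᗮ`.

Invariance of `S` passes to `S*` and to `S_F`, which gives `K⁻¹ S_F⁻¹ (K⁻¹)† = S_F⁻¹`. Since
`(K⁻¹)†` maps `Mᗮ` onto itself when `K⁻¹ M = M`, both summands of `D(S_M)` are invariant under
`K⁻¹`.
-/

namespace KInvariant

theorem mem_domRestrict_graph_iff {R E F : Type*} [Ring R] [AddCommGroup E] [Module R E]
    [AddCommGroup F] [Module R F] {T : E →ₗ.[R] F} {N : Submodule R E} {x : E} {y : F} :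
    (x, y) ∈ (T.domRestrict N).graph ↔ x ∈ N ∧ (x, y) ∈ T.graph := by
  simp only [LinearPMap.mem_graph_iff]
  constructor
  · rintro ⟨⟨x, hxN, hxT⟩, rfl, rfl⟩
    exact ⟨hxN, ⟨x, hxT⟩, rfl, rfl⟩
  · rintro ⟨hxN, ⟨x, hxT⟩, rfl, rfl⟩
    exact ⟨⟨x, hxN, hxT⟩, rfl, rfl⟩

variable {𝕜 E F : Type*} [RCLike 𝕜] [NormedAddCommGroup E] [InnerProductSpace 𝕜 E]
  [NormedAddCommGroup F] [InnerProductSpace 𝕜 F]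

theorem mem_adjoint_graph_iff [CompleteSpace E] {T : E →ₗ.[𝕜] F}
    (hT : Dense (T.domain : Set E)) {y : F} {z : E} :
    (y, z) ∈ (T†).graph ↔ ∀ x : T.domain, ⟪z, (x : E)⟫_𝕜 = ⟪y, T x⟫_𝕜 := by
  rw [LinearPMap.mem_graph_iff]
  constructor
  · rintro ⟨y, rfl, rfl⟩
    exact LinearPMap.adjoint_isFormalAdjoint hT y
  · exact fun h ↦ ⟨⟨y, LinearPMap.mem_adjoint_domain_of_exists y ⟨z, h⟩⟩, rfl,
      LinearPMap.adjoint_apply_eq hT _ h⟩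

theorem orthogonal_map_eq_comap_adjoint [CompleteSpace E] [CompleteSpace F] (A : E →L[𝕜] F)
    (U : Submodule 𝕜 E) :
    (U.map (A : E →ₗ[𝕜] F))ᗮ = Uᗮ.comap (A.adjoint : F →ₗ[𝕜] E) := by
  ext y
  simp [Submodule.mem_orthogonal, ContinuousLinearMap.adjoint_inner_right]

theorem adjoint_adjoint_symm_apply [CompleteSpace E] [CompleteSpace F] (K : E ≃L[𝕜] F) (x : E) :
    (K : E →L[𝕜] F).adjoint ((K.symm : F →L[𝕜] E).adjoint x) = x :=
  ext_inner_right 𝕜 fun v ↦ by simp [ContinuousLinearMap.adjoint_inner_left]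

theorem adjoint_symm_adjoint_apply [CompleteSpace E] [CompleteSpace F] (K : E ≃L[𝕜] F) (y : F) :
    (K.symm : F →L[𝕜] E).adjoint ((K : E →L[𝕜] F).adjoint y) = y :=
  adjoint_adjoint_symm_apply K.symm y

theorem map_adjoint_symm_orthogonal [CompleteSpace E] {K : E ≃L[𝕜] E} {M : Submodule 𝕜 E}
    (hKM : M.map (K.symm : E →ₗ[𝕜] E) = M) :
    Mᗮ.map ((K.symm : E →L[𝕜] E).adjoint : E →ₗ[𝕜] E) = Mᗮ := by
  have hcomap : Mᗮ = Mᗮ.comap ((K.symm : E →L[𝕜] E).adjoint : E →ₗ[𝕜] E) :=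
    (congrArg _ hKM.symm).trans (orthogonal_map_eq_comap_adjoint (K.symm : E →L[𝕜] E) M)
  conv_lhs => rw [hcomap]
  exact Submodule.map_comap_eq_of_surjective
    (fun y ↦ ⟨_, adjoint_symm_adjoint_apply K y⟩) _

theorem cauchySeq_iff_tendsto_inner_sub_self {ι : Type*} [Nonempty ι] [SemilatticeSup ι]
    {u : ι → E} :
    CauchySeq u ↔
      Tendsto (fun p : ι × ι ↦ ⟪u p.1 - u p.2, u p.1 - u p.2⟫_𝕜) atTop (𝓝 0) := by
  have hnorm (p : ι × ι) : ‖⟪u p.1 - u p.2, u p.1 - u p.2⟫_𝕜‖ = dist (u p.1) (u p.2) ^ 2 := by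
    rw [inner_self_eq_norm_sq_to_K, norm_pow, RCLike.norm_ofReal, abs_norm, dist_eq_norm]
  rw [cauchySeq_iff_tendsto_dist_atTop_0,
    tendsto_zero_iff_norm_tendsto_zero (f := fun p ↦ inner _ _ _)]
  simp only [hnorm]
  refine ⟨fun h ↦ by simpa using h.pow 2, fun h ↦ ?_⟩
  simpa [Real.sqrt_sq] using h.sqrt

variable {H : Type*} [NormedAddCommGroup H] [InnerProductSpace ℂ H]

section EnergySpace

variable {S : H →ₗ.[ℂ] H} (hS : IsStrictlyPosSymmetric S)

/-- The domain of a strictly positive symmetric operator `S`, as a type of its own so that it can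
carry the energy inner product `⟪f, S g⟫` instead of the one inherited from `H`. -/
def FormCore (_ : IsStrictlyPosSymmetric S) : Type _ := S.domain

namespace FormCore

noncomputable instance : AddCommGroup (FormCore hS) := inferInstanceAs (AddCommGroup S.domain)

noncomputable instance : Module ℂ (FormCore hS) := inferInstanceAs (Module ℂ S.domain)

/-- The identity map between the two copies of `D(S)`, which carry different norms. -/
noncomputable def toDomain : FormCore hS ≃ₗ[ℂ] S.domain := LinearEquiv.refl ℂ S.domain

noncomputable instance : InnerProductSpace.Core ℂ (FormCore hS) where
  inner f g := ⟪(toDomain hS f : H), S (toDomain hS g)⟫_ℂ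
  conj_inner_symm _ _ := (inner_conj_symm _ _).trans (hS.symm _ _)
  re_inner_nonneg _ := hS.isNonnegSymmetric.nonneg _
  add_left _ _ _ := inner_add_left _ _ _
  smul_left _ _ _ := inner_smul_left _ _ _
  definite f hf := by
    obtain ⟨ε, hε, hpos⟩ := hS.pos
    have hle : ε * ‖(toDomain hS f : H)‖ ^ 2 ≤ 0 :=
      (hpos _).trans_eq ((congrArg Complex.re hf).trans Complex.zero_re)
    have hf0 : (toDomain hS f : H) = 0 := by simpa using nonpos_of_mul_nonpos_right hle hε
    exact (toDomain hS).map_eq_zero_iff.1 (Subtype.ext hf0)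

noncomputable instance : NormedAddCommGroup (FormCore hS) :=
  InnerProductSpace.Core.toNormedAddCommGroup (𝕜 := ℂ)

noncomputable instance : InnerProductSpace ℂ (FormCore hS) := InnerProductSpace.ofCore _

theorem inner_def (f g : FormCore hS) :
    ⟪f, g⟫_ℂ = ⟪(toDomain hS f : H), S (toDomain hS g)⟫_ℂ :=
  rfl

theorem exists_norm_toDomain_le :
    ∃ C : ℝ, ∀ f : FormCore hS, ‖(toDomain hS f : H)‖ ≤ C * ‖f‖ := by
  obtain ⟨ε, hε, hpos⟩ := hS.pos
  refine ⟨(√ε)⁻¹, fun f ↦ ?_⟩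
  have hsq : ε * ‖(toDomain hS f : H)‖ ^ 2 ≤ ‖f‖ ^ 2 := by
    rw [norm_sq_eq_re_inner (𝕜 := ℂ) f, inner_def]
    exact hpos _
  rw [inv_mul_eq_div, le_div_iff₀' (Real.sqrt_pos.2 hε),
    ← pow_le_pow_iff_left₀ (by positivity) (norm_nonneg f) two_ne_zero, mul_pow,
    Real.sq_sqrt hε.le]
  exact hsq

/-- The inclusion of `D(S)`, with the energy norm, into `H`. -/
noncomputable def toAmbient : FormCore hS →L[ℂ] H :=
  LinearMap.mkContinuousOfExistsBound (S.domain.subtype ∘ₗ (toDomain hS).toLinearMap)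
    (exists_norm_toDomain_le hS)

end FormCore

theorem inFormDomain_iff_exists_cauchySeq {g : H} :
    InFormDomain S g ↔ ∃ f : ℕ → FormCore hS, CauchySeq f ∧
      Tendsto (fun n ↦ FormCore.toAmbient hS (f n)) atTop (𝓝 g) := by
  simp only [cauchySeq_iff_tendsto_inner_sub_self (𝕜 := ℂ), FormCore.inner_def, map_sub]
  exact ⟨fun ⟨f, hfg, hf⟩ ↦ ⟨fun n ↦ (FormCore.toDomain hS).symm (f n), hf, hfg⟩,
    fun ⟨f, hf, hfg⟩ ↦ ⟨fun n ↦ FormCore.toDomain hS (f n), hfg, hf⟩⟩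

/-- The energy space of `S`: the Hilbert space completion of `D(S)` in the energy norm. -/
abbrev EnergySpace : Type _ := UniformSpace.Completion (FormCore hS)

variable [CompleteSpace H]

namespace EnergySpace

/-- The map of the energy space into `H` that extends the inclusion of `D(S)`. -/
noncomputable def toAmbient : EnergySpace hS →L[ℂ] H :=
  (FormCore.toAmbient hS).extend UniformSpace.Completion.toComplL

theorem toAmbient_coe (f : FormCore hS) :
    toAmbient hS f = FormCore.toAmbient hS f :=
  (FormCore.toAmbient hS).extend_eq UniformSpace.Completion.denseRange_coe
    (UniformSpace.Completion.isUniformInducing_coe _) f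

theorem inner_coe_right (v : EnergySpace hS) (f : FormCore hS) :
    ⟪v, (f : EnergySpace hS)⟫_ℂ = ⟪toAmbient hS v, S (FormCore.toDomain hS f)⟫_ℂ := by
  induction v using UniformSpace.Completion.induction_on with
  | hp => exact isClosed_eq (by fun_prop) (by fun_prop)
  | ih g =>
    rw [UniformSpace.Completion.inner_coe, toAmbient_coe, FormCore.inner_def]
    rfl

theorem inFormDomain_iff_exists_toAmbient_eq {g : H} :
    InFormDomain S g ↔ ∃ v, toAmbient hS v = g := by
  have hcoe (f : ℕ → FormCore hS) :
      CauchySeq (fun n ↦ (f n : EnergySpace hS)) ↔ CauchySeq f :=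
    (UniformSpace.Completion.isUniformInducing_coe _).cauchy_map_iff (F := map f atTop)
  have htendsto {f : ℕ → FormCore hS} {v : EnergySpace hS}
      (hv : Tendsto (fun n ↦ (f n : EnergySpace hS)) atTop (𝓝 v)) :
      Tendsto (fun n ↦ FormCore.toAmbient hS (f n)) atTop (𝓝 (toAmbient hS v)) := by
    simpa only [Function.comp_def, toAmbient_coe] using
      ((toAmbient hS).continuous.tendsto v).comp hv
  rw [inFormDomain_iff_exists_cauchySeq hS]
  constructor
  · rintro ⟨f, hf, hfg⟩
    obtain ⟨v, hv⟩ := cauchySeq_tendsto_of_complete ((hcoe f).2 hf)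
    exact ⟨v, tendsto_nhds_unique (htendsto hv) hfg⟩
  · rintro ⟨v, rfl⟩
    obtain ⟨u, hu, huv⟩ := mem_closure_iff_seq_limit.1
      (UniformSpace.Completion.denseRange_coe (α := FormCore hS) v)
    choose f hf using hu
    obtain rfl : (fun n ↦ (f n : EnergySpace hS)) = u := funext hf
    exact ⟨f, (hcoe f).1 huv.cauchySeq, htendsto huv⟩

end EnergySpace

end EnergySpace

theorem mem_inverseImage_iff {T : H →ₗ.[ℂ] H} (hT : LinearMap.ker T.toFun = ⊥)
    {N : Submodule ℂ H} {x : H} :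
    x ∈ inverseImage T N ↔ ∃ η ∈ N, (x, η) ∈ T.graph := by
  have hgraph (η : H) : (x, η) ∈ T.graph ↔ (η, x) ∈ T.inverse.graph := by
    simp [LinearPMap.inverse_graph hT]
  simp only [hgraph, LinearPMap.mem_graph_iff]
  constructor
  · rintro ⟨η, hη, rfl⟩
    exact ⟨η, hη, η, rfl, rfl⟩
  · rintro ⟨_, hη, η, rfl, rfl⟩
    exact ⟨η, hη, rfl⟩

section Operators

variable [CompleteSpace H] {S : H →ₗ.[ℂ] H}

theorem mem_kerAdjoint_iff {y : H} : y ∈ kerAdjoint S ↔ (y, 0) ∈ (S†).graph := by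
  rw [LinearPMap.mem_graph_iff]
  simp only [kerAdjoint, Submodule.mem_map, LinearMap.mem_ker, Submodule.subtype_apply,
    LinearPMap.toFun_eq_coe, and_comm]

theorem kerAdjoint_eq_orthogonal_range (hS : Dense (S.domain : Set H)) :
    kerAdjoint S = (LinearMap.range S.toFun)ᗮ := by
  ext y
  rw [mem_kerAdjoint_iff, mem_adjoint_graph_iff hS, Submodule.mem_orthogonal']
  simp only [inner_zero_left, LinearMap.mem_range, forall_exists_index, forall_apply_eq_imp_iff,
    LinearPMap.toFun_eq_coe, eq_comm (a := (0 : ℂ))]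

theorem mem_friedrichs_graph_iff (hS : IsNonnegSymmetric S) {x y : H} :
    (x, y) ∈ (friedrichs S hS).graph ↔ (x, y) ∈ (S†).graph ∧ InFormDomain S x := by
  simp only [LinearPMap.mem_graph_iff]
  constructor
  · rintro ⟨⟨z, hz, hform⟩, rfl, rfl⟩
    exact ⟨⟨⟨z, hz⟩, rfl, rfl⟩, hform⟩
  · rintro ⟨⟨⟨z, hz⟩, rfl, rfl⟩, hform⟩
    exact ⟨⟨z, hz, hform⟩, rfl, rfl⟩

theorem IsNonnegSymmetric.le_adjoint (hS : IsNonnegSymmetric S) : S ≤ S† :=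
  LinearPMap.IsFormalAdjoint.le_adjoint hS.dense hS.symm

theorem IsNonnegSymmetric.le_friedrichs (hS : IsNonnegSymmetric S) : S ≤ friedrichs S hS := by
  rw [← LinearPMap.le_graph_iff]
  rintro ⟨x, y⟩ hxy
  refine (mem_friedrichs_graph_iff hS).2
    ⟨LinearPMap.le_graph_of_le hS.le_adjoint hxy, fun _ ↦ ⟨x, ?_⟩, tendsto_const_nhds, ?_⟩
  · exact LinearPMap.mem_domain_of_mem_graph hxy
  · simp

theorem IsNonnegSymmetric.le_extension (hS : IsNonnegSymmetric S) (M : Submodule ℂ H) :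
    S ≤ extension S hS M :=
  ⟨le_inf (le_sup_left.trans le_sup_left) hS.le_adjoint.1, fun _ _ hxy ↦ hS.le_adjoint.2 hxy⟩

end Operators

section FriedrichsInverse

variable [CompleteSpace H] {S : H →ₗ.[ℂ] H} (hS : IsStrictlyPosSymmetric S)

theorem EnergySpace.mem_adjoint_graph_iff_eq_adjoint_toAmbient {v : EnergySpace hS} {y : H} :
    (toAmbient hS v, y) ∈ (S†).graph ↔ v = (toAmbient hS).adjoint y := by
  have hpair (f : FormCore hS) : ⟪(toAmbient hS).adjoint y, (f : EnergySpace hS)⟫_ℂ =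
      ⟪y, (FormCore.toDomain hS f : H)⟫_ℂ := by
    rw [ContinuousLinearMap.adjoint_inner_left, toAmbient_coe]
    rfl
  rw [mem_adjoint_graph_iff hS.dense]
  constructor
  · refine fun h ↦ UniformSpace.Completion.denseRange_coe.eq_of_inner_left ℂ ?_
    intro f
    rw [inner_coe_right, hpair, h]
  · rintro rfl x
    obtain ⟨f, rfl⟩ := (FormCore.toDomain hS).surjective x
    rw [← inner_coe_right, hpair]

/-- The inverse of the Friedrichs extension of a strictly positive symmetric operator, as a
bounded operator `ι ι†` where `ι` is the map of the energy space into `H`. -/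
noncomputable def friedrichsInverse : H →L[ℂ] H :=
  EnergySpace.toAmbient hS ∘L (EnergySpace.toAmbient hS).adjoint

theorem mem_friedrichs_graph_iff_friedrichsInverse_eq {x y : H} :
    (x, y) ∈ (friedrichs S hS.isNonnegSymmetric).graph ↔ friedrichsInverse hS y = x := by
  rw [mem_friedrichs_graph_iff, EnergySpace.inFormDomain_iff_exists_toAmbient_eq hS]
  constructor
  · rintro ⟨hxy, v, rfl⟩
    rw [EnergySpace.mem_adjoint_graph_iff_eq_adjoint_toAmbient] at hxy
    rw [hxy]
    rfl
  · rintro rfl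
    exact ⟨(EnergySpace.mem_adjoint_graph_iff_eq_adjoint_toAmbient hS).2 rfl, _, rfl⟩

theorem friedrichsInverse_mem_friedrichs_graph (y : H) :
    (friedrichsInverse hS y, y) ∈ (friedrichs S hS.isNonnegSymmetric).graph :=
  (mem_friedrichs_graph_iff_friedrichsInverse_eq hS).2 rfl

theorem friedrichsInverse_injective : Function.Injective (friedrichsInverse hS) := fun y z hyz ↦
  LinearPMap.mem_graph_snd_inj _ (friedrichsInverse_mem_friedrichs_graph hS y)
    (friedrichsInverse_mem_friedrichs_graph hS z) hyz

theorem ker_friedrichs : LinearMap.ker (friedrichs S hS.isNonnegSymmetric).toFun = ⊥ := by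
  refine LinearMap.ker_eq_bot'.2 fun x hx ↦ Subtype.ext ?_
  have hgraph := LinearPMap.mem_graph _ x
  rw [← LinearPMap.toFun_eq_coe, hx, mem_friedrichs_graph_iff_friedrichsInverse_eq hS,
    map_zero] at hgraph
  exact hgraph.symm

theorem inverse_friedrichs_domain : (friedrichs S hS.isNonnegSymmetric).inverse.domain = ⊤ := by
  rw [LinearPMap.inverse_domain]
  exact LinearMap.range_eq_top.2 fun y ↦
    LinearPMap.mem_range_iff.2 ⟨_, friedrichsInverse_mem_friedrichs_graph hS y⟩

theorem friedrichsPart_eq_map (M : Submodule ℂ H) :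
    friedrichsPart S hS.isNonnegSymmetric M =
      (Mᗮ ⊓ kerAdjoint S).map (friedrichsInverse hS : H →ₗ[ℂ] H) := by
  ext x
  simp only [friedrichsPart, mem_inverseImage_iff (ker_friedrichs hS),
    mem_friedrichs_graph_iff_friedrichsInverse_eq hS, Submodule.mem_map,
    ContinuousLinearMap.coe_coe]

theorem mem_range_iff_friedrichsInverse_mem_graph {y : H} :
    y ∈ LinearMap.range S.toFun ↔ (friedrichsInverse hS y, y) ∈ S.graph := by
  refine LinearPMap.mem_range_iff.trans ⟨?_, fun h ↦ ⟨_, h⟩⟩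
  rintro ⟨x, hxy⟩
  rwa [(mem_friedrichs_graph_iff_friedrichsInverse_eq hS).1
    (LinearPMap.le_graph_of_le hS.isNonnegSymmetric.le_friedrichs hxy)]

include hS in
theorem IsStrictlyPosSymmetric.isClosed_range (hclosed : S.IsClosed) :
    IsClosed (LinearMap.range S.toFun : Set H) := by
  have hpre : (LinearMap.range S.toFun : Set H) =
      (fun y ↦ (friedrichsInverse hS y, y)) ⁻¹' (S.graph : Set (H × H)) :=
    Set.ext fun _ ↦ mem_range_iff_friedrichsInverse_mem_graph hS
  rw [hpre]
  exact IsClosed.preimage (by fun_prop) hclosed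

theorem map_friedrichsInverse_range :
    (LinearMap.range S.toFun).map (friedrichsInverse hS : H →ₗ[ℂ] H) = S.domain := by
  ext x
  rw [LinearPMap.mem_domain_iff]
  constructor
  · rintro ⟨y, hy, rfl⟩
    exact ⟨y, (mem_range_iff_friedrichsInverse_mem_graph hS).1 hy⟩
  · rintro ⟨y, hxy⟩
    exact ⟨y, LinearPMap.mem_range_iff.2 ⟨x, hxy⟩,
      (mem_friedrichs_graph_iff_friedrichsInverse_eq hS).1
        (LinearPMap.le_graph_of_le hS.isNonnegSymmetric.le_friedrichs hxy)⟩

end FriedrichsInverse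

section Extension

variable [CompleteSpace H] {S : H →ₗ.[ℂ] H} (hS : IsStrictlyPosSymmetric S) {M : Submodule ℂ H}

theorem extensionDomain_eq_sup_map (hclosed : S.IsClosed) (hM : M ≤ kerAdjoint S) :
    extensionDomain S hS.isNonnegSymmetric M =
      M ⊔ Mᗮ.map (friedrichsInverse hS : H →ₗ[ℂ] H) := by
  have := (hS.isClosed_range hclosed).completeSpace_coe
  have hle : LinearMap.range S.toFun ≤ Mᗮ := by
    rw [kerAdjoint_eq_orthogonal_range hS.dense] at hM
    exact (Submodule.le_orthogonal_orthogonal _).trans (Submodule.orthogonal_le hM)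
  calc
    _ = M ⊔ (S.domain ⊔ friedrichsPart S hS.isNonnegSymmetric M) := by
      rw [extensionDomain, sup_comm S.domain, sup_assoc]
    _ = M ⊔ (LinearMap.range S.toFun ⊔ Mᗮ ⊓ kerAdjoint S).map
        (friedrichsInverse hS : H →ₗ[ℂ] H) := by
      rw [Submodule.map_sup, map_friedrichsInverse_range, friedrichsPart_eq_map]
    _ = _ := by
      rw [kerAdjoint_eq_orthogonal_range hS.dense, inf_comm,
        Submodule.sup_orthogonal_inf_of_hasOrthogonalProjection hle]

theorem friedrichsPart_le_domain :
    friedrichsPart S hS.isNonnegSymmetric M ≤ (friedrichs S hS.isNonnegSymmetric).domain := by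
  rw [friedrichsPart_eq_map hS]
  rintro _ ⟨η, -, rfl⟩
  exact LinearPMap.mem_domain_of_mem_graph (friedrichsInverse_mem_friedrichs_graph hS η)

theorem disjoint_friedrichs_domain_kerAdjoint :
    Disjoint (friedrichs S hS.isNonnegSymmetric).domain (kerAdjoint S) := by
  rw [Submodule.disjoint_def]
  intro x hx hker
  obtain ⟨y, hxy⟩ := LinearPMap.mem_domain_iff.1 hx
  have hy : y = 0 := LinearPMap.mem_graph_snd_inj _ ((mem_friedrichs_graph_iff _).1 hxy).1
    (mem_kerAdjoint_iff.1 hker) rfl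
  rw [← (mem_friedrichs_graph_iff_friedrichsInverse_eq hS).1 hxy, hy, map_zero]

theorem disjoint_domain_friedrichsPart :
    Disjoint S.domain (friedrichsPart S hS.isNonnegSymmetric M) := by
  have hdisj : Disjoint (LinearMap.range S.toFun) (Mᗮ ⊓ kerAdjoint S) := by
    rw [kerAdjoint_eq_orthogonal_range hS.dense]
    exact (Submodule.orthogonal_disjoint _).mono_right inf_le_right
  have hmap := Submodule.disjoint_map (friedrichsInverse_injective hS) hdisj
  rwa [map_friedrichsInverse_range, ← friedrichsPart_eq_map] at hmap

theorem iSupIndep_extensionDomain (hM : M ≤ kerAdjoint S) :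
    iSupIndep ![S.domain, M, friedrichsPart S hS.isNonnegSymmetric M] := by
  have hMdisj : Disjoint (S.domain ⊔ friedrichsPart S hS.isNonnegSymmetric M) M :=
    (disjoint_friedrichs_domain_kerAdjoint hS).mono
      (sup_le hS.isNonnegSymmetric.le_friedrichs.1 (friedrichsPart_le_domain hS)) hM
  have hpart := disjoint_domain_friedrichsPart hS (M := M)
  refine iSupIndep_fin_three.2 ⟨?_, ?_, ?_⟩
  · exact sup_comm M _ ▸ hpart.disjoint_sup_right_of_disjoint_sup_left hMdisj
  · exact sup_comm S.domain _ ▸ hMdisj.symm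
  · exact hpart.symm.disjoint_sup_right_of_disjoint_sup_left (sup_comm S.domain _ ▸ hMdisj)

theorem extension_domain (hM : M ≤ kerAdjoint S) :
    (extension S hS.isNonnegSymmetric M).domain = extensionDomain S hS.isNonnegSymmetric M := by
  have hker : kerAdjoint S ≤ (S†).domain := Submodule.map_subtype_le _ _
  have hfriedrichs : (friedrichs S hS.isNonnegSymmetric).domain ≤ (S†).domain := fun _ h ↦ h.1
  exact inf_eq_left.2 <| sup_le (sup_le hS.isNonnegSymmetric.le_adjoint.1 (hM.trans hker))
    ((friedrichsPart_le_domain hS).trans hfriedrichs)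

end Extension

section Conjugation

variable [CompleteSpace H] (K : H ≃L[ℂ] H) {S T : H →ₗ.[ℂ] H}

theorem mem_conjugate_graph_iff {x y : H} :
    (x, y) ∈ (conjugate K T).graph ↔
      (K x, (K.symm : H →L[ℂ] H).adjoint y) ∈ T.graph := by
  simp only [LinearPMap.mem_graph_iff]
  constructor
  · rintro ⟨z, rfl, rfl⟩
    exact ⟨⟨K z, z.2⟩, rfl, (adjoint_symm_adjoint_apply K _).symm⟩
  · rintro ⟨⟨_, hz⟩, rfl, hy⟩
    refine ⟨⟨x, hz⟩, rfl, ?_⟩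
    rw [← adjoint_adjoint_symm_apply K y, ← hy]
    rfl

theorem dense_conjugate_domain (hT : Dense (T.domain : Set H)) :
    Dense ((conjugate K T).domain : Set H) :=
  hT.preimage K.toHomeomorph.isOpenMap

/-- The restriction of `K` to a bijection of `{f | K f ∈ D(T)}` onto `D(T)`. -/
noncomputable def conjugateDomainEquiv (T : H →ₗ.[ℂ] H) : (conjugate K T).domain ≃ₗ[ℂ] T.domain :=
  K.toLinearEquiv.ofSubmodule' T.domain

theorem conjugateDomainEquiv_coe (x : (conjugate K T).domain) :
    (conjugateDomainEquiv K T x : H) = K x :=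
  rfl

theorem conjugate_apply (x : (conjugate K T).domain) :
    conjugate K T x = (K : H →L[ℂ] H).adjoint (T (conjugateDomainEquiv K T x)) :=
  rfl

theorem adjoint_conjugate (hS : Dense (S.domain : Set H)) :
    (conjugate K S)† = conjugate K (S†) :=
  LinearPMap.eq_of_eq_graph <| by
    ext ⟨y, z⟩
    rw [mem_conjugate_graph_iff, mem_adjoint_graph_iff hS,
      mem_adjoint_graph_iff (dense_conjugate_domain K hS),
      (conjugateDomainEquiv K S).surjective.forall]
    simp only [conjugateDomainEquiv_coe, conjugate_apply, ContinuousLinearMap.adjoint_inner_left,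
      ContinuousLinearMap.adjoint_inner_right, ContinuousLinearEquiv.coe_coe,
      K.symm_apply_apply]

theorem inFormDomain_conjugate_iff {g : H} :
    InFormDomain (conjugate K S) g ↔ InFormDomain S (K g) := by
  unfold InFormDomain
  rw [((conjugateDomainEquiv K S).surjective.comp_left (α := ℕ)).exists]
  refine exists_congr fun f ↦ and_congr K.toHomeomorph.isInducing.tendsto_nhds_iff ?_
  simp only [conjugate_apply, ContinuousLinearMap.adjoint_inner_right, Function.comp_apply,
    ← map_sub, conjugateDomainEquiv_coe, ContinuousLinearEquiv.coe_coe]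

theorem conjugate_friedrichs (hS : IsNonnegSymmetric S) (hKS : conjugate K S = S) :
    conjugate K (friedrichs S hS) = friedrichs S hS :=
  LinearPMap.eq_of_eq_graph <| by
    ext ⟨x, y⟩
    rw [mem_conjugate_graph_iff, mem_friedrichs_graph_iff, mem_friedrichs_graph_iff,
      ← inFormDomain_conjugate_iff, ← mem_conjugate_graph_iff, ← adjoint_conjugate K hS.dense,
      hKS]

theorem friedrichsInverse_adjoint_symm_apply (hS : IsStrictlyPosSymmetric S)
    (hKS : conjugate K S = S) (y : H) :
    friedrichsInverse hS ((K.symm : H →L[ℂ] H).adjoint y) = K (friedrichsInverse hS y) := by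
  rw [← mem_friedrichs_graph_iff_friedrichsInverse_eq, ← mem_conjugate_graph_iff,
    conjugate_friedrichs K _ hKS]
  exact friedrichsInverse_mem_friedrichs_graph hS y

theorem comap_extensionDomain (hS : IsStrictlyPosSymmetric S) (hclosed : S.IsClosed)
    (hKS : conjugate K S = S) {M : Submodule ℂ H} (hM : M ≤ kerAdjoint S)
    (hKM : M.map (K.symm : H →ₗ[ℂ] H) = M) :
    (extensionDomain S hS.isNonnegSymmetric M).comap (K : H →ₗ[ℂ] H) =
      extensionDomain S hS.isNonnegSymmetric M := by
  have hcomp : (K.symm : H →ₗ[ℂ] H) ∘ₗ (friedrichsInverse hS : H →ₗ[ℂ] H) ∘ₗ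
      ((K.symm : H →L[ℂ] H).adjoint : H →ₗ[ℂ] H) = friedrichsInverse hS :=
    LinearMap.ext fun y ↦ K.symm_apply_eq.2 (friedrichsInverse_adjoint_symm_apply K hS hKS y)
  have hmap : (Mᗮ.map (friedrichsInverse hS : H →ₗ[ℂ] H)).map (K.symm : H →ₗ[ℂ] H) =
      Mᗮ.map (friedrichsInverse hS : H →ₗ[ℂ] H) := by
    conv_lhs => rw [← map_adjoint_symm_orthogonal hKM]
    rw [← Submodule.map_comp, ← Submodule.map_comp, LinearMap.comp_assoc, hcomp]
  rw [extensionDomain_eq_sup_map hS hclosed hM]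
  refine (Submodule.comap_equiv_eq_map_symm K.toLinearEquiv _).trans ?_
  exact (Submodule.map_sup _ _ _).trans (congrArg₂ _ hKM hmap)

theorem conjugate_extension (hS : IsStrictlyPosSymmetric S) (hclosed : S.IsClosed)
    (hKS : conjugate K S = S) {M : Submodule ℂ H} (hM : M ≤ kerAdjoint S)
    (hKM : M.map (K.symm : H →ₗ[ℂ] H) = M) :
    conjugate K (extension S hS.isNonnegSymmetric M) = extension S hS.isNonnegSymmetric M :=
  LinearPMap.eq_of_eq_graph <| by
    ext ⟨x, y⟩
    have hdomain : K x ∈ extensionDomain S hS.isNonnegSymmetric M ↔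
        x ∈ extensionDomain S hS.isNonnegSymmetric M :=
      SetLike.ext_iff.1 (comap_extensionDomain K hS hclosed hKS hM hKM) x
    rw [mem_conjugate_graph_iff, extension, mem_domRestrict_graph_iff, mem_domRestrict_graph_iff,
      hdomain, ← mem_conjugate_graph_iff, ← adjoint_conjugate K hS.dense, hKS]

variable {K} in
theorem IsKInvariant.extension (hS : IsStrictlyPosSymmetric S) (hclosed : S.IsClosed)
    (hinv : IsKInvariant K S) {M : Submodule ℂ H} (hM : M ≤ kerAdjoint S)
    (hKM : M.map (K.symm : H →ₗ[ℂ] H) = M) :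
    IsKInvariant K (extension S hS.isNonnegSymmetric M) where
  dense := hS.dense.mono (hS.isNonnegSymmetric.le_extension M).1
  closable := (LinearPMap.adjoint_isClosed hS.dense).isClosable.leIsClosable
    LinearPMap.domRestrict_le
  conjugate_eq := conjugate_extension K hS hclosed hinv.conjugate_eq hM hKM

end Conjugation

end KInvariant

theorem mainTheorem8_general {H : Type*} [NormedAddCommGroup H] [InnerProductSpace ℂ H]
    [CompleteSpace H] (K : H ≃L[ℂ] H) (S : H →ₗ.[ℂ] H)
    (hS : KInvariant.IsStrictlyPosSymmetric S) (hclosed : S.IsClosed)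
    (hinv : KInvariant.IsKInvariant K S)
    (M : Submodule ℂ H) (hMker : M ≤ KInvariant.kerAdjoint S)
    (hKM : M.map (K.symm : H →ₗ[ℂ] H) = M) :
    LinearMap.ker (KInvariant.friedrichs S hS.isNonnegSymmetric).toFun = ⊥ ∧
    (KInvariant.friedrichs S hS.isNonnegSymmetric).inverse.domain = ⊤ ∧
    iSupIndep ![S.domain, M, KInvariant.friedrichsPart S hS.isNonnegSymmetric M] ∧
    (KInvariant.extension S hS.isNonnegSymmetric M).domain =
      KInvariant.extensionDomain S hS.isNonnegSymmetric M ∧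
    S ≤ KInvariant.extension S hS.isNonnegSymmetric M ∧
    KInvariant.IsKInvariant K (KInvariant.extension S hS.isNonnegSymmetric M) :=
  ⟨KInvariant.ker_friedrichs hS,
    KInvariant.inverse_friedrichs_domain hS,
    KInvariant.iSupIndep_extensionDomain hS hMker,
    KInvariant.extension_domain hS hMker,
    hS.isNonnegSymmetric.le_extension M,
    hinv.extension hS hclosed hMker hKM⟩

theorem mainTheorem8 {H : Type*} [NormedAddCommGroup H] [InnerProductSpace ℂ H] [CompleteSpace H]
    (K : H ≃L[ℂ] H) (S : H →ₗ.[ℂ] H)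
    (hS : KInvariant.IsStrictlyPosSymmetric S) (hclosed : S.IsClosed)
    (hinv : KInvariant.IsKInvariant K S)
    (M : Submodule ℂ H) (hMclosed : IsClosed (M : Set H))
    (hMker : M ≤ KInvariant.kerAdjoint S)
    (hKM : M.map (K.symm : H →ₗ[ℂ] H) = M) :
    -- `S_F` is a bijection from its domain onto `H`, so that `S_F⁻¹` is defined on all of `H`
    LinearMap.ker (KInvariant.friedrichs S hS.isNonnegSymmetric).toFun = ⊥ ∧
    (KInvariant.friedrichs S hS.isNonnegSymmetric).inverse.domain = ⊤ ∧
    -- the sum defining the domain of `S_M` is direct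
    iSupIndep ![S.domain, M, KInvariant.friedrichsPart S hS.isNonnegSymmetric M] ∧
    -- `S_M` has that sum as its domain and extends `S`
    (KInvariant.extension S hS.isNonnegSymmetric M).domain =
      KInvariant.extensionDomain S hS.isNonnegSymmetric M ∧
    S ≤ KInvariant.extension S hS.isNonnegSymmetric M ∧
    -- `S_M` is `K`-invariant
    KInvariant.IsKInvariant K (KInvariant.extension S hS.isNonnegSymmetric M) :=
  mainTheorem8_general K S hS hclosed hinv M hMker hKM
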